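/- Let $K$ be a non-zero associative ring, not necessarily commutative or unital, whose center $Z(K)$ contains a set of s-units for $K$; that is, for every $k\in K$ there is $k'\in Z(K)$ with $kk'=k$. Let $G$ be a Hausdorff ample groupoid with non-empty unit space $G_0$. Here $G$ is a small category in which every morphism is invertible, whose set $G_1$ of morphisms carries a Hausdorff topology for which inversion and composition are continuous; the set $G_0$ of objects is identified with the set of identity morphisms and has the subspace topology; $G_0$ is locally compact Hausdorff, the domain map $d\colon G_1\to G_0$ is a local homeomorphism, and $G_1$ has a basis of compact open bisections, a bisection being a subset $U\subseteq G_1$ such that $d|_U$ and the restriction $c|_U$ of the codomain map are homeomorphisms onto their images. Let $A_K(G)$ be the Steinberg algebra of $G$ over $K$, that is, the ring of compactly supported locally constant functions $G_1\to K$ with pointwise addition and the convolution product $(f*g)(a)=\sum_{bc=a}f(b)g(c)$. Then $A_K(G)$ is simple if and only if the following three conditions hold: (i) $G$ is effective, i.e. the interior of $\{g\in G_1 : d(g)=c(g)\}$ in $G_1$ is $G_0$; (ii) $G$ is minimal, i.e. $\emptyset$ and $G_0$ are the only open subsets $U$ of $G_0$ with $d(c^{-1}(U))=U$; (iii) $K$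 is simple. Here a ring is called simple if it is non-zero and its only two-sided ideals are $\{0\}$ and the ring itself. -/

import Mathlib

namespace SteinbergAlgebra

section Arrows

open CategoryTheory

universe v u

/-- The set `G₁` of all morphisms of the groupoid `G` whose set of objects `G₀` is `X`. -/
abbrev Arr (X : Type u) [Groupoid.{v} X] : Type (max u v) := Quiver.Total X

variable {X : Type u} [Groupoid.{v} X]

/-- The domain `d(g)` of a morphism. -/
def dom (g : Arr X) : X := g.left

/-- The codomain `c(g)` of a morphism. -/
def cod (g : Arr X) : X := g.right

/-- The identity morphism at an object. -/
def unit (x : X) : Arr X := ⟨x, x, 𝟙 x⟩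

/-- The inverse of a morphism. -/
def inv (g : Arr X) : Arr X := ⟨g.right, g.left, Groupoid.inv g.hom⟩

/-- The composite `gh` (first `h`, then `g`) of a composable pair, i.e. `d(g) = c(h)`. -/
def comp (g h : Arr X) (w : dom g = cod h) : Arr X :=
  ⟨h.left, g.right, h.hom ≫ eqToHom w.symm ≫ g.hom⟩

@[simp] theorem dom_unit (x : X) : dom (unit x) = x := rfl
@[simp] theorem cod_unit (x : X) : cod (unit x) = x := rfl
@[simp] theorem dom_inv (g : Arr X) : dom (inv g) = cod g := rfl
@[simp] theorem cod_inv (g : Arr X) : cod (inv g) = dom g := rfl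
@[simp] theorem dom_comp (g h : Arr X) (w : dom g = cod h) : dom (comp g h w) = dom h := rfl
@[simp] theorem cod_comp (g h : Arr X) (w : dom g = cod h) : cod (comp g h w) = cod g := rfl

theorem comp_mk {a b c : X} (f : b ⟶ c) (g : a ⟶ b) (w) :
    comp (⟨b, c, f⟩ : Arr X) ⟨a, b, g⟩ w = ⟨a, c, g ≫ f⟩ := by
  change (⟨a, c, g ≫ 𝟙 b ≫ f⟩ : Arr X) = _
  rw [Category.id_comp]

@[simp] theorem inv_inv (g : Arr X) : inv (inv g) = g := by
  rcases g with ⟨a, b, f⟩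
  simp [inv]

theorem inv_comp (g : Arr X) : comp (inv g) g rfl = unit (dom g) := by
  rcases g with ⟨a, b, f⟩
  simp only [inv, comp_mk, Groupoid.comp_inv]
  rfl

theorem comp_inv (g : Arr X) : comp g (inv g) rfl = unit (cod g) := by
  rcases g with ⟨a, b, f⟩
  simp only [inv, comp_mk, Groupoid.inv_comp]
  rfl

theorem unit_comp (g : Arr X) (x : X) (w : dom (unit x) = cod g) : comp (unit x) g w = g := by
  rcases g with ⟨a, b, f⟩
  change x = b at w
  subst w
  simp only [unit, comp_mk, Category.comp_id]

theorem comp_unit (g : Arr X) (x : X) (w : dom g = cod (unit x)) : comp g (unit x) w = g := by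
  rcases g with ⟨a, b, f⟩
  change a = x at w
  subst w
  simp only [unit, comp_mk, Category.id_comp]

theorem comp_assoc (g h k : Arr X) (w : dom g = cod h) (w' : dom h = cod k) :
    comp (comp g h w) k w' = comp g (comp h k w') w := by
  rcases g with ⟨a, b, f⟩
  rcases h with ⟨c, d, f'⟩
  rcases k with ⟨a', b', f''⟩
  change a = d at w
  change c = b' at w'
  subst w
  subst w'
  change (⟨_, _, f'' ≫ 𝟙 _ ≫ (f' ≫ 𝟙 _ ≫ f)⟩ : Arr X) = ⟨_, _, (f'' ≫ 𝟙 _ ≫ f') ≫ 𝟙 _ ≫ f⟩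
  simp only [Category.id_comp, Category.assoc]

theorem inv_comp_comp (g h : Arr X) (w : dom g = cod h) :
    comp (inv g) (comp g h w) rfl = h := by
  rw [← comp_assoc (inv g) g h rfl w]
  simp only [inv_comp]
  exact unit_comp _ _ _

theorem comp_inv_comp (g a : Arr X) (w : cod g = cod a) :
    comp g (comp (inv g) a w) rfl = a := by
  rw [← comp_assoc g (inv g) a rfl w]
  simp only [comp_inv]
  exact unit_comp _ _ _

theorem comp_congr_right (g : Arr X) {a b : Arr X} (e : a = b) (w : dom g = cod a)
    (w' : dom g = cod b) : comp g a w = comp g b w' := by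
  subst e
  rfl

theorem comp_left_cancel (g : Arr X) {a b : Arr X} (w : dom g = cod a) (w' : dom g = cod b)
    (e : comp g a w = comp g b w') : a = b := by
  rw [← inv_comp_comp g a w, ← inv_comp_comp g b w']
  exact comp_congr_right _ e _ _

theorem inv_comp_eq (b c a : Arr X) (w : dom b = cod c) (h : cod (comp b c w) = cod a)
    (hb : cod b = cod a) (hc : cod c = cod (comp (inv b) a hb)) :
    comp (inv (comp b c w)) a h = comp (inv c) (comp (inv b) a hb) hc := by
  refine comp_left_cancel (comp b c w) rfl rfl ?_
  refine (comp_inv_comp _ a h).trans ?_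
  refine Eq.trans ?_ (comp_assoc b c _ w rfl).symm
  refine (comp_inv_comp b a hb).symm.trans ?_
  exact comp_congr_right b (comp_inv_comp c _ hc).symm _ _

end Arrows

section Topology

open CategoryTheory Topology

universe v u

/-- A topological groupoid. The unit space `G₀ = X` carries the topology that it has as a subspace
of `G₁`, objects being identified with their identity morphisms. -/
class IsTopologicalGroupoid (X : Type u) [Groupoid.{v} X] [TopologicalSpace X]
    [TopologicalSpace (Arr X)] : Prop where
  isInducing_unit : IsInducing (unit : X → Arr X)
  continuous_inv : Continuous (inv : Arr X → Arr X)
  continuous_comp :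
    Continuous fun p : {p : Arr X × Arr X // dom p.1 = cod p.2} => comp p.1.1 p.1.2 p.2

/-- An étale groupoid. -/
class IsEtaleGroupoid (X : Type u) [Groupoid.{v} X] [TopologicalSpace X]
    [TopologicalSpace (Arr X)] : Prop extends IsTopologicalGroupoid X where
  locallyCompactSpace : LocallyCompactSpace X
  t2Space : T2Space X
  isLocalHomeomorph_dom : IsLocalHomeomorph (dom : Arr X → X)

/-- A bisection: a set of morphisms on which both `c` and `d` restrict to homeomorphisms
(onto their images). -/
def IsBisection {X : Type u} [Groupoid.{v} X] [TopologicalSpace X] [TopologicalSpace (Arr X)]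
    (U : Set (Arr X)) : Prop :=
  IsEmbedding (U.domRestrict cod) ∧ IsEmbedding (U.domRestrict dom)

/-- An ample groupoid: an étale groupoid whose compact open bisections form a basis of `G₁`. -/
class IsAmpleGroupoid (X : Type u) [Groupoid.{v} X] [TopologicalSpace X]
    [TopologicalSpace (Arr X)] : Prop extends IsEtaleGroupoid X where
  isTopologicalBasis :
    TopologicalSpace.IsTopologicalBasis {U : Set (Arr X) | IsCompact U ∧ IsOpen U ∧ IsBisection U}

/-- A set of units `U` is invariant if `d(c⁻¹(U)) = U`. -/
def IsInvariant {X : Type u} [Groupoid.{v} X] (U : Set X) : Prop :=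
  dom '' (cod ⁻¹' U : Set (Arr X)) = U

/-- The groupoid is minimal if the only open invariant sets of units are `∅` and `G₀`. -/
def IsMinimal (X : Type u) [Groupoid.{v} X] [TopologicalSpace X] : Prop :=
  ∀ U : Set X, IsOpen U → IsInvariant U → U = ∅ ∨ U = Set.univ

/-- The groupoid is effective if the interior of its isotropy is the set of identities. -/
def IsEffective (X : Type u) [Groupoid.{v} X] [TopologicalSpace (Arr X)] : Prop :=
  interior {g : Arr X | dom g = cod g} = Set.range (unit : X → Arr X)

variable {X : Type u} [Groupoid.{v} X] [TopologicalSpace X] [TopologicalSpace (Arr X)]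

theorem continuous_inv [IsTopologicalGroupoid X] : Continuous (inv : Arr X → Arr X) :=
  IsTopologicalGroupoid.continuous_inv

theorem continuous_dom [IsTopologicalGroupoid X] : Continuous (dom : Arr X → X) := by
  rw [(IsTopologicalGroupoid.isInducing_unit (X := X)).continuous_iff]
  have h : (unit ∘ dom : Arr X → Arr X) = (fun p : {p : Arr X × Arr X // dom p.1 = cod p.2} =>
      comp p.1.1 p.1.2 p.2) ∘ fun g => ⟨(inv g, g), rfl⟩ := by
    funext g
    exact (inv_comp g).symm
  rw [h]
  exact IsTopologicalGroupoid.continuous_comp.comp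
    ((continuous_inv.prodMk continuous_id).subtype_mk _)

theorem continuous_cod [IsTopologicalGroupoid X] : Continuous (cod : Arr X → X) :=
  continuous_dom.comp continuous_inv

theorem isOpenMap_cod [IsEtaleGroupoid X] : IsOpenMap (cod : Arr X → X) := by
  intro U hU
  have h : cod '' U = dom '' (inv ⁻¹' U : Set (Arr X)) := by
    ext x
    constructor
    · rintro ⟨g, hg, rfl⟩
      exact ⟨inv g, by simpa using hg, rfl⟩
    · rintro ⟨g, hg, rfl⟩
      exact ⟨inv g, hg, rfl⟩
  rw [h]
  exact (IsEtaleGroupoid.isLocalHomeomorph_dom (X := X)).isOpenMap _ (hU.preimage continuous_inv)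

theorem IsBisection.injOn_cod {U : Set (Arr X)} (hU : IsBisection U) : Set.InjOn cod U :=
  Set.injOn_iff_injective.2 hU.1.injective

end Topology

section Algebra

open CategoryTheory Topology

universe w v u

/-- The additive group of compactly supported locally constant functions `G₁ → K`. -/
def steinbergSubgroup (K : Type w) [NonUnitalRing K] (X : Type u) [Groupoid.{v} X]
    [TopologicalSpace (Arr X)] : AddSubgroup (Arr X → K) where
  carrier := {f | IsLocallyConstant f ∧ HasCompactSupport f}
  zero_mem' := ⟨IsLocallyConstant.const 0, HasCompactSupport.zero⟩
  add_mem' hf hg := ⟨hf.1.add hg.1, hf.2.add hg.2⟩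
  neg_mem' hf := ⟨hf.1.neg, hf.2.neg⟩

/-- The factorizations `a = bc` of a morphism `a`. -/
def Factorization {X : Type u} [Groupoid.{v} X] (a : Arr X) : Type (max u v) :=
  {p : Arr X × Arr X // ∃ w : dom p.1 = cod p.2, comp p.1 p.2 w = a}

/-- The convolution `(f * g)(a) = ∑_{bc = a} f(b) g(c)`. The sum has only finitely many nonzero
terms when `f` is in the Steinberg algebra of an ample groupoid
(see `finite_support_convolution`). -/
noncomputable def convolution {K : Type w} [NonUnitalRing K] {X : Type u} [Groupoid.{v} X]
    (f g : Arr X → K) (a : Arr X) : K :=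
  ∑ᶠ p : Factorization a, f p.1.1 * g p.1.2

variable {K : Type w} [NonUnitalRing K] {X : Type u} [Groupoid.{v} X]

theorem Factorization.ext_fst {a : Arr X} {p q : Factorization a} (h : p.1.1 = q.1.1) :
    p = q := by
  obtain ⟨⟨b, c⟩, w, hp⟩ := p
  obtain ⟨⟨b', c'⟩, w', hq⟩ := q
  simp only at h w w' hp hq
  subst h
  have h1 := inv_comp_comp b c w
  have h2 := inv_comp_comp b c' w'
  have : c = c' := by
    rw [← h1, ← h2]
    congr 1
    rw [hp, hq]
  subst this
  rfl

theorem Factorization.cod_fst {a : Arr X} (p : Factorization a) : cod p.1.1 = cod a := by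
  obtain ⟨⟨b, c⟩, w, rfl⟩ := p
  rfl

/-- The factorization `a = b (b⁻¹ a)`. -/
def Factorization.of (a b : Arr X) (h : cod b = cod a) : Factorization a :=
  ⟨(b, comp (inv b) a h), rfl, comp_inv_comp b a h⟩

theorem convolution_eq_single {f g : Arr X → K} {U : Set (Arr X)} (hU : Set.InjOn cod U)
    (hf : Function.support f ⊆ U) {a b : Arr X} (hb : b ∈ U) (h : cod b = cod a) :
    convolution f g a = f b * g (comp (inv b) a h) := by
  unfold convolution
  rw [finsum_eq_single _ (Factorization.of a b h)]
  · rfl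
  · intro p hp
    by_contra hne
    have hpU : p.1.1 ∈ U := hf fun h0 => hne (by rw [h0, zero_mul])
    exact hp (Factorization.ext_fst (hU hpU hb (p.cod_fst.trans h.symm)))

theorem convolution_eq_zero {f g : Arr X → K} {U : Set (Arr X)}
    (hf : Function.support f ⊆ U) {a : Arr X} (h : ∀ b ∈ U, cod b ≠ cod a) :
    convolution f g a = 0 := by
  unfold convolution
  refine finsum_eq_zero_of_forall_eq_zero fun p => ?_
  by_contra hne
  exact h _ (hf fun h0 => hne (by rw [h0, zero_mul])) p.cod_fst

variable [TopologicalSpace (Arr X)]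

theorem indicator_mem {f : Arr X → K} (hf : f ∈ steinbergSubgroup K X) {U : Set (Arr X)}
    (hU : IsClopen U) : U.indicator f ∈ steinbergSubgroup K X := by
  classical
  refine ⟨?_, hf.2.mono (by rw [Set.support_indicator]; exact Set.inter_subset_right)⟩
  rw [IsLocallyConstant.iff_eventually_eq]
  intro a
  by_cases ha : a ∈ U
  · filter_upwards [hU.2.mem_nhds ha, hf.1.eventually_eq a] with b hb hb'
    rw [Set.indicator_of_mem hb, Set.indicator_of_mem ha, hb']
  · filter_upwards [hU.1.isOpen_compl.mem_nhds ha] with b hb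
    rw [Set.indicator_of_notMem hb, Set.indicator_of_notMem ha]

variable [TopologicalSpace X]

theorem exists_finite_cover [IsAmpleGroupoid X] {C : Set (Arr X)} (hC : IsCompact C) :
    ∃ s : Finset (Set (Arr X)), (∀ U ∈ s, IsCompact U ∧ IsOpen U ∧ IsBisection U) ∧
      C ⊆ ⋃ U ∈ s, U := by
  have hB := IsAmpleGroupoid.isTopologicalBasis (X := X)
  obtain ⟨t, ht⟩ := hC.elim_finite_subcover
    (fun U : {U : Set (Arr X) // IsCompact U ∧ IsOpen U ∧ IsBisection U} => U.1)
    (fun U => U.2.2.1) (by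
      intro g _
      obtain ⟨U, hU, hg, -⟩ := hB.exists_subset_of_mem_open (Set.mem_univ g) isOpen_univ
      exact Set.mem_iUnion.2 ⟨⟨U, hU⟩, hg⟩)
  classical
  refine ⟨t.image Subtype.val, ?_, ?_⟩
  · intro U hU
    obtain ⟨V, -, rfl⟩ := Finset.mem_image.1 hU
    exact V.2
  · intro g hg
    obtain ⟨U, hU, hgU⟩ := Set.mem_iUnion₂.1 (ht hg)
    exact Set.mem_iUnion₂.2 ⟨U.1, Finset.mem_image_of_mem _ hU, hgU⟩

theorem finite_support_convolution [IsAmpleGroupoid X] {f : Arr X → K}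
    (hf : f ∈ steinbergSubgroup K X) (g : Arr X → K) (a : Arr X) :
    (Function.support fun p : Factorization a => f p.1.1 * g p.1.2).Finite := by
  obtain ⟨s, hs, hcov⟩ := exists_finite_cover hf.2
  have hfin : (Function.support f ∩ {b | cod b = cod a}).Finite := by
    refine Set.Finite.subset (s := ⋃ U ∈ s, (U ∩ {b | cod b = cod a})) ?_ ?_
    · refine s.finite_toSet.biUnion fun U hU => Set.Subsingleton.finite ?_
      intro b hb b' hb'
      exact (hs U hU).2.2.injOn_cod hb.1 hb'.1 (hb.2.trans hb'.2.symm)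
    · rintro b ⟨hb, hba⟩
      obtain ⟨U, hU, hbU⟩ := Set.mem_iUnion₂.1 (hcov (subset_tsupport f hb))
      exact Set.mem_iUnion₂.2 ⟨U, hU, hbU, hba⟩
  refine Set.Finite.of_finite_image (f := fun p : Factorization a => p.1.1) (hfin.subset ?_)
    fun p _ q _ h => Factorization.ext_fst h
  rintro _ ⟨p, hp, rfl⟩
  exact ⟨fun h0 => hp (by simp only [h0, zero_mul]), p.cod_fst⟩

theorem convolution_add_left [IsAmpleGroupoid X] {f f' : Arr X → K}
    (hf : f ∈ steinbergSubgroup K X) (hf' : f' ∈ steinbergSubgroup K X) (g : Arr X → K) :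
    convolution (f + f') g = convolution f g + convolution f' g := by
  funext a
  simp only [convolution, Pi.add_apply, add_mul]
  exact finsum_add_distrib (finite_support_convolution hf g a)
    (finite_support_convolution hf' g a)

theorem convolution_add_right [IsAmpleGroupoid X] {f : Arr X → K}
    (hf : f ∈ steinbergSubgroup K X) (g g' : Arr X → K) :
    convolution f (g + g') = convolution f g + convolution f g' := by
  funext a
  simp only [convolution, Pi.add_apply, mul_add]
  exact finsum_add_distrib (finite_support_convolution hf g a)
    (finite_support_convolution hf g' a)


theorem exists_comp_inv_nhds [IsTopologicalGroupoid X] {a b : Arr X} (h : cod b = cod a)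
    {W : Set (Arr X)} (hW : IsOpen W) (hm : comp (inv b) a h ∈ W) :
    ∃ A B : Set (Arr X), IsOpen A ∧ IsOpen B ∧ a ∈ A ∧ b ∈ B ∧
      ∀ a' ∈ A, ∀ b' ∈ B, ∀ h' : cod b' = cod a', comp (inv b') a' h' ∈ W := by
  have hc : Continuous fun p : {p : Arr X × Arr X // cod p.1 = cod p.2} =>
      comp (inv p.1.1) p.1.2 p.2 :=
    Continuous.comp
      (g := fun q : {q : Arr X × Arr X // dom q.1 = cod q.2} => comp q.1.1 q.1.2 q.2)
      (f := fun p : {p : Arr X × Arr X // cod p.1 = cod p.2} =>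
        (⟨(inv p.1.1, p.1.2), p.2⟩ : {q : Arr X × Arr X // dom q.1 = cod q.2}))
      IsTopologicalGroupoid.continuous_comp
      (((continuous_inv.comp (continuous_fst.comp continuous_subtype_val)).prodMk
        (continuous_snd.comp continuous_subtype_val)).subtype_mk _)
  obtain ⟨V, hV, hVW⟩ := isOpen_induced_iff.1 (hW.preimage hc)
  have hmem : (b, a) ∈ V := by
    have : (⟨(b, a), h⟩ : {p : Arr X × Arr X // cod p.1 = cod p.2}) ∈ Subtype.val ⁻¹' V := by
      rw [hVW]
      exact hm
    exact this
  obtain ⟨B, A, hB, hA, hbB, haA, hBA⟩ := isOpen_prod_iff.1 hV b a hmem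
  refine ⟨A, B, hA, hB, haA, hbB, fun a' ha' b' hb' h' => ?_⟩
  have : (⟨(b', a'), h'⟩ : {p : Arr X × Arr X // cod p.1 = cod p.2}) ∈ Subtype.val ⁻¹' V :=
    hBA (Set.mk_mem_prod hb' ha')
  rw [hVW] at this
  exact this

/-- Functions supported in a compact open bisection generate the Steinberg algebra additively. -/
theorem steinberg_induction [IsAmpleGroupoid X] [T2Space (Arr X)] {P : (Arr X → K) → Prop}
    (zero : P 0)
    (add : ∀ f ∈ steinbergSubgroup K X, ∀ g ∈ steinbergSubgroup K X, P f → P g → P (f + g))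
    (bisection : ∀ f ∈ steinbergSubgroup K X, ∀ U : Set (Arr X),
      IsCompact U → IsOpen U → IsBisection U → Function.support f ⊆ U → P f)
    (f : Arr X → K) (hf : f ∈ steinbergSubgroup K X) : P f := by
  classical
  obtain ⟨s, hs, hcov⟩ := exists_finite_cover hf.2
  replace hcov := (subset_tsupport f).trans hcov
  induction s using Finset.induction_on generalizing f with
  | empty =>
    have : f = 0 := by
      rw [← Function.support_eq_empty_iff, Set.eq_empty_iff_forall_notMem]
      intro g hg
      simpa using hcov hg
    rw [this]
    exact zero
  | insert U s _ ih =>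
    have hU := hs U (Finset.mem_insert_self U s)
    have hcl : IsClopen U := ⟨hU.1.isClosed, hU.2.1⟩
    rw [← Set.indicator_self_add_compl U f]
    refine add _ (indicator_mem hf hcl) _ (indicator_mem hf hcl.compl)
      (bisection _ (indicator_mem hf hcl) U hU.1 hU.2.1 hU.2.2 Set.support_indicator_subset)
      (ih _ (indicator_mem hf hcl.compl) (fun V hV => hs V (Finset.mem_insert_of_mem hV)) ?_)
    intro g hg
    rw [Function.mem_support, Set.indicator_apply_ne_zero] at hg
    have := hcov hg.2
    rw [Finset.set_biUnion_insert] at this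
    exact this.resolve_left hg.1

theorem convolution_mem [IsAmpleGroupoid X] [T2Space (Arr X)] {f g : Arr X → K}
    (hf : f ∈ steinbergSubgroup K X) (hg : g ∈ steinbergSubgroup K X) :
    convolution f g ∈ steinbergSubgroup K X := by
  have := IsEtaleGroupoid.t2Space (X := X)
  refine ⟨?_, ?_⟩
  · refine steinberg_induction (P := fun f => IsLocallyConstant (convolution f g)) ?_ ?_ ?_ f hf
    · have : convolution (0 : Arr X → K) g = fun _ => 0 := by
        funext a
        simp [convolution]
      rw [this]
      exact IsLocallyConstant.const 0
    · intro f hf f' hf' h h'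
      rw [convolution_add_left hf hf']
      exact h.add h'
    · intro f hf U hUc hUo hU hfU
      rw [IsLocallyConstant.iff_eventually_eq]
      intro a
      by_cases ha : ∃ b ∈ U, cod b = cod a
      · obtain ⟨b, hb, hba⟩ := ha
        obtain ⟨A, B, hA, hB, haA, hbB, hAB⟩ := exists_comp_inv_nhds hba
          (hg.1.isOpen_fiber (g (comp (inv b) a hba))) rfl
        have hB' : IsOpen (B ∩ {b' | f b' = f b} ∩ U) :=
          (hB.inter (hf.1.isOpen_fiber _)).inter hUo
        have hN := ((isOpenMap_cod _ hB').preimage continuous_cod).mem_nhds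
          (x := a) ⟨b, ⟨⟨hbB, rfl⟩, hb⟩, hba⟩
        filter_upwards [hA.mem_nhds haA, hN] with a' ha' hN'
        obtain ⟨b', ⟨⟨hb'B, hb'f⟩, hb'U⟩, hb'a'⟩ := hN'
        rw [convolution_eq_single hU.injOn_cod hfU hb hba,
          convolution_eq_single hU.injOn_cod hfU hb'U hb'a']
        have h1 : f b' = f b := hb'f
        have h2 : g (comp (inv b') a' hb'a') = g (comp (inv b) a hba) := hAB a' ha' b' hb'B hb'a'
        rw [h1, h2]
      · have hcl : IsClosed (cod '' U) := (hUc.image continuous_cod).isClosed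
        filter_upwards [(hcl.isOpen_compl.preimage continuous_cod).mem_nhds (x := a)
          (by rintro ⟨b, hb, hba⟩; exact ha ⟨b, hb, hba⟩)] with a' ha'
        rw [convolution_eq_zero hfU fun b hb hba => ha ⟨b, hb, hba⟩,
          convolution_eq_zero hfU fun b hb hba => ha' ⟨b, hb, hba⟩]
  · have hcl : IsClosed {p : Arr X × Arr X | dom p.1 = cod p.2} :=
      isClosed_eq (continuous_dom.comp continuous_fst) (continuous_cod.comp continuous_snd)
    have hC := ((Topology.IsClosedEmbedding.subtypeVal hcl).isCompact_preimage
      (hf.2.isCompact.prod hg.2.isCompact)).image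
        (IsTopologicalGroupoid.continuous_comp (X := X))
    refine HasCompactSupport.intro hC fun a ha => ?_
    refine finsum_eq_zero_of_forall_eq_zero fun p => ?_
    by_contra hne
    obtain ⟨⟨b, c⟩, w, rfl⟩ := p
    refine ha ⟨⟨(b, c), w⟩, ⟨subset_tsupport f fun h0 => hne ?_,
      subset_tsupport g fun h0 => hne ?_⟩, rfl⟩
    · simp only [h0, zero_mul]
    · simp only [h0, mul_zero]

theorem convolution_assoc [IsAmpleGroupoid X] [T2Space (Arr X)] {f g : Arr X → K}
    (hf : f ∈ steinbergSubgroup K X) (hg : g ∈ steinbergSubgroup K X)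
    (h : Arr X → K) :
    convolution (convolution f g) h = convolution f (convolution g h) := by
  have hzero : ∀ k : Arr X → K, convolution (0 : Arr X → K) k = 0 := by
    intro k
    funext a
    simp [convolution]
  have hzero' : ∀ k : Arr X → K, convolution k (0 : Arr X → K) = 0 := by
    intro k
    funext a
    simp [convolution]
  revert g
  refine steinberg_induction (P := fun f => ∀ {g : Arr X → K}, g ∈ steinbergSubgroup K X →
    convolution (convolution f g) h = convolution f (convolution g h)) ?_ ?_ ?_ f hf
  · intro g _
    simp only [hzero]
  · intro f hf f' hf' ih ih' g hg
    rw [convolution_add_left hf hf', convolution_add_left (convolution_mem hf hg)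
      (convolution_mem hf' hg), ih hg, ih' hg, convolution_add_left hf hf']
  intro f hf U _ _ hU hfU g hg
  refine steinberg_induction (P := fun g =>
    convolution (convolution f g) h = convolution f (convolution g h)) ?_ ?_ ?_ g hg
  · simp only [hzero, hzero']
  · intro g hg g' hg' ih ih'
    rw [convolution_add_right hf, convolution_add_left (convolution_mem hf hg)
      (convolution_mem hf hg'), ih, ih', convolution_add_left hg hg', convolution_add_right hf]
  intro g hg V _ _ hV hgV
  let W : Set (Arr X) := {a | ∃ b ∈ U, ∃ c ∈ V, ∃ w : dom b = cod c, comp b c w = a}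
  have hWinj : Set.InjOn cod W := by
    rintro _ ⟨b, hb, c, hc, w, rfl⟩ _ ⟨b', hb', c', hc', w', rfl⟩ e
    obtain rfl : b = b' := hU.injOn_cod hb hb' e
    obtain rfl : c = c' := hV.injOn_cod hc hc' (w.symm.trans w')
    rfl
  have hW : Function.support (convolution f g) ⊆ W := by
    intro a ha
    by_contra hn
    refine ha (finsum_eq_zero_of_forall_eq_zero fun p => ?_)
    by_contra hne
    obtain ⟨⟨b, c⟩, w, rfl⟩ := p
    exact hn ⟨b, hfU fun h0 => hne (by simp only [h0, zero_mul]), c,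
      hgV fun h0 => hne (by simp only [h0, mul_zero]), w, rfl⟩
  funext a
  by_cases ha : ∃ b ∈ U, cod b = cod a
  · obtain ⟨b, hb, hba⟩ := ha
    rw [convolution_eq_single hU.injOn_cod hfU hb hba]
    by_cases hc : ∃ c ∈ V, cod c = cod (comp (inv b) a hba)
    · obtain ⟨c, hc, hca⟩ := hc
      have w : dom b = cod c := hca.symm
      have hbc : comp b c w ∈ W := ⟨b, hb, c, hc, w, rfl⟩
      rw [convolution_eq_single hV.injOn_cod hgV hc hca,
        convolution_eq_single hWinj hW hbc (show cod (comp b c w) = cod a from hba),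
        convolution_eq_single hU.injOn_cod hfU hb (show cod b = cod (comp b c w) from rfl),
        inv_comp_comp, mul_assoc]
      exact congrArg (fun k => f b * (g c * h k)) (inv_comp_eq b c a w _ hba hca)
    · rw [convolution_eq_zero hgV fun c hcV hca => hc ⟨c, hcV, hca⟩, mul_zero]
      refine convolution_eq_zero hW ?_
      rintro _ ⟨b', hb', c, hcV, w, rfl⟩ e
      obtain rfl : b = b' := hU.injOn_cod hb hb' (hba.trans e.symm)
      exact hc ⟨c, hcV, w.symm⟩
  · rw [convolution_eq_zero hfU fun b hb hba => ha ⟨b, hb, hba⟩]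
    refine convolution_eq_zero hW ?_
    rintro _ ⟨b', hb', c, hcV, w, rfl⟩ e
    exact ha ⟨b', hb', e⟩

end Algebra

section Ring

open CategoryTheory

universe w v u

/-- The Steinberg algebra `A_K(G)`: compactly supported locally constant functions `G₁ → K` with
pointwise addition and convolution. -/
def _root_.SteinbergAlgebra (K : Type w) [NonUnitalRing K] (X : Type u) [Groupoid.{v} X]
    [TopologicalSpace (Arr X)] : Type (max u v w) :=
  steinbergSubgroup K X

variable (K : Type w) [NonUnitalRing K] (X : Type u) [Groupoid.{v} X] [TopologicalSpace (Arr X)]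

instance : AddCommGroup (SteinbergAlgebra K X) :=
  inferInstanceAs (AddCommGroup (steinbergSubgroup K X))

variable [TopologicalSpace X] [IsAmpleGroupoid X] [T2Space (Arr X)]

noncomputable instance : NonUnitalRing (SteinbergAlgebra K X) :=
  { (inferInstance : AddCommGroup (SteinbergAlgebra K X)) with
    mul := fun f g => ⟨convolution f.1 g.1, convolution_mem f.2 g.2⟩
    left_distrib := fun f g h => Subtype.ext (convolution_add_right f.2 g.1 h.1)
    right_distrib := fun f g h => Subtype.ext (convolution_add_left f.2 g.2 h.1)
    zero_mul := fun f => Subtype.ext (funext fun a => by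
      change convolution (0 : Arr X → K) f.1 a = 0
      simp [convolution])
    mul_zero := fun f => Subtype.ext (funext fun a => by
      change convolution f.1 (0 : Arr X → K) a = 0
      simp [convolution])
    mul_assoc := fun f g h => Subtype.ext (convolution_assoc f.2 g.2 h.1) }

end Ring

section Coefficients

/-- `Z(K)` contains a set of s-units for `K`. -/
def CenterContainsSUnits (K : Type*) [NonUnitalRing K] : Prop :=
  ∀ k : K, ∃ k' ∈ NonUnitalSubring.center K, k * k' = k

end Coefficients

end SteinbergAlgebra

/-!
The idea is to relate ideals of the Steinberg algebra `A_K(G)` to ideals of `K` and to invariant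
open sets of units, through the functions `k 1_U` (`charFun`) for compact open sets `U` of arrows.

Each failing condition yields a proper nonzero ideal. An ideal `I` of `K` gives the ideal of
functions with values in `I` (`coeffIdeal`), and an invariant open set `U` of units gives the ideal
of functions supported on the arrows with end points in `U` (`invariantIdeal`). For effectiveness,
`A_K(G)` acts on the finitely supported `K`-valued functions on `G₀`, the matrix entry of `f` at
`(y, x)` being the sum of `f` over all arrows from `x` to `y` (`homSum`). The kernel of this action
is an ideal (`homSumIdeal`) that never contains `k 1_V` for `k ≠ 0` and `V` a nonempty set of units.
If `U` is a compact open bisection of non-identity isotropy arrows, then `k 1_U - k 1_{d(U)}` is a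
nonzero element of it.

Conversely, let `J` be a nonzero ideal and let the three conditions hold. Multiplying by a function
supported on a bisection produces an element `f` of `J` that is nonzero at an identity. The part of
`f` off the identities has compact support, so effectiveness gives a nonempty open set of units
between whose points this part vanishes (`IsEffective.exists_open_avoiding`), and multiplying `f` on
both sides by `k' 1_V`, for a small `V` and a central s-unit `k'`, gives `k 1_V ∈ J` with `k ≠ 0`
(`exists_charFun_units_mem`). Simplicity of `K` then gives `l 1_V ∈ J` for all `l`
(`charFun_mem_of_charFun_mem`). So the open set `fullUnits J` of units near which `J` contains every
function is nonempty. It is invariant, since `J` can be transported along bisections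
(`dom_mem_fullUnits`), hence it is all of `G₀` by minimality, and compactness of supports gives
`J = A_K(G)` (`mem_of_fullUnits_eq_univ`). The s-units replace the identity of `K` throughout.
-/

namespace SteinbergAlgebra

/-! ### Convolution with functions supported on bisections -/

section Convolution

open CategoryTheory

universe w v u

variable {X : Type u} [Groupoid.{v} X]

theorem inv_unit (x : X) : inv (unit x) = unit x := by
  exact (comp_unit (inv (unit x)) x rfl).symm.trans (inv_comp (unit x))

theorem comp_inv_cancel_right (b c : Arr X) (w : dom b = cod c) :
    comp (comp b c w) (inv c) rfl = b := by
  rw [comp_assoc b c (inv c) w rfl]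
  simp only [comp_inv]
  exact comp_unit _ _ _

theorem inv_comp_cancel_right (a c : Arr X) (w : dom a = dom c) :
    comp (comp a (inv c) w) c rfl = a := by
  rw [comp_assoc a (inv c) c w rfl]
  simp only [inv_comp]
  exact comp_unit _ _ _

theorem injOn_cod_range_unit : Set.InjOn cod (Set.range (unit : X → Arr X)) := by
  rintro _ ⟨x, rfl⟩ _ ⟨y, rfl⟩ h
  exact congrArg unit h

theorem injOn_dom_range_unit : Set.InjOn dom (Set.range (unit : X → Arr X)) := by
  rintro _ ⟨x, rfl⟩ _ ⟨y, rfl⟩ h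
  exact congrArg unit h

theorem mem_range_unit_iff {g : Arr X} :
    g ∈ Set.range (unit : X → Arr X) ↔ unit (dom g) = g :=
  ⟨fun ⟨_, hx⟩ => hx ▸ rfl, fun h => ⟨_, h⟩⟩

theorem IsInvariant.cod_mem_iff {U : Set X} (hU : IsInvariant U) (g : Arr X) :
    cod g ∈ U ↔ dom g ∈ U := by
  constructor
  · intro h
    rw [← hU]
    exact ⟨g, h, rfl⟩
  · intro h
    rw [← hU]
    exact ⟨inv g, h, rfl⟩

theorem Factorization.dom_snd {a : Arr X} (p : Factorization a) : dom p.1.2 = dom a := by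
  obtain ⟨⟨b, c⟩, w, rfl⟩ := p
  rfl

theorem Factorization.ext_snd {a : Arr X} {p q : Factorization a} (h : p.1.2 = q.1.2) :
    p = q := by
  refine Factorization.ext_fst ?_
  obtain ⟨⟨b, c⟩, w, hp⟩ := p
  obtain ⟨⟨b', c'⟩, w', hq⟩ := q
  simp only at h w w' hp hq ⊢
  subst h
  rw [← comp_inv_cancel_right b c w, ← comp_inv_cancel_right b' c w']
  congr 1
  rw [hp, hq]

/-- The factorization `a = (a c⁻¹) c`. -/
def Factorization.ofSnd (a c : Arr X) (h : dom a = dom c) : Factorization a :=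
  ⟨(comp a (inv c) h, c), rfl, inv_comp_cancel_right a c h⟩

variable {K : Type w} [NonUnitalRing K]

theorem convolution_eq_single_right {f g : Arr X → K} {U : Set (Arr X)} (hU : Set.InjOn dom U)
    (hg : Function.support g ⊆ U) {a c : Arr X} (hc : c ∈ U) (h : dom a = dom c) :
    convolution f g a = f (comp a (inv c) h) * g c := by
  unfold convolution
  rw [finsum_eq_single _ (Factorization.ofSnd a c h)]
  · rfl
  · intro p hp
    by_contra hne
    have hpU : p.1.2 ∈ U := hg fun h0 => hne (by rw [h0, mul_zero])
    exact hp (Factorization.ext_snd (hU hpU hc (p.dom_snd.trans h)))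

theorem convolution_eq_zero_of_dom {f g : Arr X → K} {U : Set (Arr X)}
    (hg : Function.support g ⊆ U) {a : Arr X} (h : ∀ c ∈ U, dom c ≠ dom a) :
    convolution f g a = 0 := by
  unfold convolution
  refine finsum_eq_zero_of_forall_eq_zero fun p => ?_
  by_contra hne
  exact h _ (hg fun h0 => hne (by rw [h0, mul_zero])) p.dom_snd

/-- Left convolution with a function supported on units is pointwise multiplication. -/
theorem convolution_units_left {f : Arr X → K}
    (hf : Function.support f ⊆ Set.range (unit : X → Arr X)) (g : Arr X → K) (a : Arr X) :
    convolution f g a = f (unit (cod a)) * g a := by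
  refine (convolution_eq_single (a := a) (b := unit (cod a)) injOn_cod_range_unit hf
    ⟨_, rfl⟩ rfl).trans ?_
  simp only [inv_unit]
  congr 2
  exact unit_comp _ _ _

/-- Right convolution with a function supported on units is pointwise multiplication. -/
theorem convolution_units_right {g : Arr X → K}
    (hg : Function.support g ⊆ Set.range (unit : X → Arr X)) (f : Arr X → K) (a : Arr X) :
    convolution f g a = f a * g (unit (dom a)) := by
  refine (convolution_eq_single_right (a := a) (c := unit (dom a)) injOn_dom_range_unit hg
    ⟨_, rfl⟩ rfl).trans ?_
  simp only [inv_unit]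
  congr 2
  exact comp_unit _ _ _

end Convolution

/-! ### Compact open sets of units and characteristic functions -/

section CharFun

open CategoryTheory Topology

universe w v u

section

variable {X : Type u} [Groupoid.{v} X] [TopologicalSpace (Arr X)]
  {K : Type w} [NonUnitalRing K]

theorem indicator_const_mem [T2Space (Arr X)] (k : K) {U : Set (Arr X)} (hc : IsCompact U)
    (ho : IsOpen U) : (U.indicator fun _ => k) ∈ steinbergSubgroup K X := by
  classical
  refine ⟨?_, HasCompactSupport.intro hc fun a ha => Set.indicator_of_notMem ha _⟩
  rw [IsLocallyConstant.iff_eventually_eq]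
  intro a
  by_cases ha : a ∈ U
  · filter_upwards [ho.mem_nhds ha] with b hb
    rw [Set.indicator_of_mem hb, Set.indicator_of_mem ha]
  · filter_upwards [hc.isClosed.isOpen_compl.mem_nhds ha] with b hb
    rw [Set.indicator_of_notMem hb, Set.indicator_of_notMem ha]

/-- The function `k 1_U` with value `k` on the compact open set `U` and `0` elsewhere. -/
noncomputable def charFun [T2Space (Arr X)] (k : K) {U : Set (Arr X)} (hc : IsCompact U)
    (ho : IsOpen U) : SteinbergAlgebra K X :=
  ⟨U.indicator fun _ => k, indicator_const_mem k hc ho⟩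

theorem add_val (f g : SteinbergAlgebra K X) (a : Arr X) : (f + g).1 a = f.1 a + g.1 a := rfl

theorem neg_val (f : SteinbergAlgebra K X) (a : Arr X) : (-f).1 a = -f.1 a := rfl

theorem ne_zero_of_apply_ne_zero {f : SteinbergAlgebra K X} {a : Arr X} (h : f.1 a ≠ 0) :
    f ≠ 0 := by
  rintro rfl
  exact h rfl

variable [T2Space (Arr X)]

theorem charFun_of_mem (k : K) {U : Set (Arr X)} (hc : IsCompact U) (ho : IsOpen U) {a : Arr X}
    (ha : a ∈ U) : (charFun k hc ho).1 a = k :=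
  Set.indicator_of_mem ha fun _ => k

theorem charFun_of_notMem (k : K) {U : Set (Arr X)} (hc : IsCompact U) (ho : IsOpen U) {a : Arr X}
    (ha : a ∉ U) : (charFun k hc ho).1 a = 0 :=
  Set.indicator_of_notMem ha fun _ => k

theorem support_charFun_subset (k : K) {U : Set (Arr X)} (hc : IsCompact U) (ho : IsOpen U) :
    Function.support (charFun k hc ho).1 ⊆ U :=
  Set.support_indicator_subset

end

variable {X : Type u} [Groupoid.{v} X] [TopologicalSpace X] [TopologicalSpace (Arr X)]

theorem continuous_unit [IsTopologicalGroupoid X] : Continuous (unit : X → Arr X) :=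
  (IsTopologicalGroupoid.isInducing_unit (X := X)).continuous

theorem isOpen_range_unit [IsEtaleGroupoid X] : IsOpen (Set.range (unit : X → Arr X)) := by
  rw [isOpen_iff_mem_nhds]
  rintro _ ⟨x, rfl⟩
  obtain ⟨e, hxe, he⟩ := IsEtaleGroupoid.isLocalHomeomorph_dom (X := X) (unit x)
  have hO : IsOpen ((fun g : Arr X => unit (dom g)) ⁻¹' e.source) :=
    e.open_source.preimage (continuous_unit.comp continuous_dom)
  filter_upwards [e.open_source.mem_nhds hxe, hO.mem_nhds (x := unit x) hxe] with g hg hg'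
  refine mem_range_unit_iff.2 (e.injOn hg' hg ?_)
  rw [← he]
  rfl

theorem isClosed_range_unit [IsTopologicalGroupoid X] [T2Space (Arr X)] :
    IsClosed (Set.range (unit : X → Arr X)) := by
  have h : Set.range (unit : X → Arr X) = {g | unit (dom g) = g} :=
    Set.ext fun _ => mem_range_unit_iff
  rw [h]
  exact isClosed_eq (continuous_unit.comp continuous_dom) continuous_id

theorem IsBisection.injOn_dom {U : Set (Arr X)} (hU : IsBisection U) : Set.InjOn dom U :=
  Set.injOn_iff_injective.2 hU.2.injective

theorem exists_compact_open_subset [IsAmpleGroupoid X] {g : Arr X} {O : Set (Arr X)}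
    (hO : IsOpen O) (hg : g ∈ O) :
    ∃ U : Set (Arr X), IsCompact U ∧ IsOpen U ∧ IsBisection U ∧ g ∈ U ∧ U ⊆ O := by
  obtain ⟨U, ⟨h1, h2, h3⟩, h4, h5⟩ :=
    (IsAmpleGroupoid.isTopologicalBasis (X := X)).exists_subset_of_mem_open hg hO
  exact ⟨U, h1, h2, h3, h4, h5⟩

/-- Compact open sets of units form a basis of the unit space. -/
theorem exists_compact_open_units [IsAmpleGroupoid X] {x : X} {N : Set X} (hN : IsOpen N)
    (hx : x ∈ N) :
    ∃ V : Set (Arr X), IsCompact V ∧ IsOpen V ∧ unit x ∈ V ∧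
      V ⊆ Set.range (unit : X → Arr X) ∧ V ⊆ cod ⁻¹' N := by
  obtain ⟨V, h1, h2, -, h3, h4⟩ := exists_compact_open_subset (g := unit x)
    (isOpen_range_unit.inter (hN.preimage continuous_cod)) ⟨⟨x, rfl⟩, hx⟩
  exact ⟨V, h1, h2, h3, h4.trans Set.inter_subset_left, h4.trans Set.inter_subset_right⟩

theorem _root_.IsSimpleRing.mem_of_mem_of_ne_zero {R : Type*} [NonUnitalNonAssocRing R]
    (hR : IsSimpleRing R) (I : TwoSidedIdeal R) {a : R} (ha : a ∈ I) (h0 : a ≠ 0) (b : R) :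
    b ∈ I := by
  rcases hR.simple.eq_bot_or_eq_top I with rfl | rfl
  · exact absurd ((TwoSidedIdeal.mem_bot R).1 ha) h0
  · exact TwoSidedIdeal.mem_top _

end CharFun

/-! ### Necessity of simple coefficients and of minimality -/

section Necessity

open CategoryTheory Topology

universe w v u

variable {X : Type u} [Groupoid.{v} X] [TopologicalSpace X] [TopologicalSpace (Arr X)]
  {K : Type w} [NonUnitalRing K] [T2Space (Arr X)] [IsAmpleGroupoid X]

/-- The ideal of all functions with values in an ideal of the coefficient ring. -/
noncomputable def coeffIdeal (I : TwoSidedIdeal K) : TwoSidedIdeal (SteinbergAlgebra K X) :=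
  TwoSidedIdeal.mk' {f | ∀ a, f.1 a ∈ I}
    (fun _ => I.zero_mem)
    (fun hf hg a => I.add_mem (hf a) (hg a))
    (fun hf a => I.neg_mem (hf a))
    (fun {_ _} hg _ => finsum_induction (· ∈ I) I.zero_mem (fun _ _ => I.add_mem)
      fun _ => I.mul_mem_left _ _ (hg _))
    (fun {_ _} hf _ => finsum_induction (· ∈ I) I.zero_mem (fun _ _ => I.add_mem)
      fun _ => I.mul_mem_right _ _ (hf _))

theorem mem_coeffIdeal {I : TwoSidedIdeal K} {f : SteinbergAlgebra K X} :
    f ∈ coeffIdeal I ↔ ∀ a, f.1 a ∈ I :=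
  TwoSidedIdeal.mem_mk' _ _ _ _ _ _ _

theorem isSimpleRing_coeff [Nontrivial K] [Nonempty X]
    (h : IsSimpleRing (SteinbergAlgebra K X)) : IsSimpleRing K := by
  refine .of_eq_bot_or_eq_top fun I => or_iff_not_imp_left.2 fun hI => ?_
  obtain ⟨k, hk, hk0⟩ := SetLike.exists_of_lt (bot_lt_iff_ne_bot.2 hI)
  rw [TwoSidedIdeal.mem_bot] at hk0
  obtain ⟨x⟩ := ‹Nonempty X›
  obtain ⟨V, hVc, hVo, hxV, -⟩ := exists_compact_open_units isOpen_univ (Set.mem_univ x)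
  have hmem : charFun k hVc hVo ∈ coeffIdeal I := by
    refine mem_coeffIdeal.2 fun a => ?_
    by_cases ha : a ∈ V
    · rwa [charFun_of_mem k hVc hVo ha]
    · rw [charFun_of_notMem k hVc hVo ha]
      exact I.zero_mem
  refine TwoSidedIdeal.ext fun l => ⟨fun _ => TwoSidedIdeal.mem_top _, fun _ => ?_⟩
  have := mem_coeffIdeal.1 (h.mem_of_mem_of_ne_zero _ hmem
    (ne_zero_of_apply_ne_zero (a := unit x) (by rwa [charFun_of_mem k hVc hVo hxV]))
    (charFun l hVc hVo)) (unit x)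
  rwa [charFun_of_mem l hVc hVo hxV] at this

/-- The ideal of all functions supported on the arrows between points of an invariant set. -/
noncomputable def invariantIdeal (K : Type w) [NonUnitalRing K] {U : Set X}
    (hU : IsInvariant U) : TwoSidedIdeal (SteinbergAlgebra K X) :=
  TwoSidedIdeal.mk' {f | ∀ a, cod a ∉ U → f.1 a = 0}
    (fun _ _ => rfl)
    (fun {f g} hf hg a ha => by rw [add_val, hf a ha, hg a ha, add_zero])
    (fun {f} hf a ha => by rw [neg_val, hf a ha, neg_zero])
    (fun {_ _} hg _ ha => finsum_eq_zero_of_forall_eq_zero fun p => by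
      rw [hg _ (by rwa [hU.cod_mem_iff, p.dom_snd, ← hU.cod_mem_iff]), mul_zero])
    (fun {_ _} hf _ ha => finsum_eq_zero_of_forall_eq_zero fun p => by
      rw [hf _ (by rwa [p.cod_fst]), zero_mul])

theorem mem_invariantIdeal {U : Set X} (hU : IsInvariant U) {f : SteinbergAlgebra K X} :
    f ∈ invariantIdeal K hU ↔ ∀ a, cod a ∉ U → f.1 a = 0 :=
  TwoSidedIdeal.mem_mk' _ _ _ _ _ _ _

theorem isMinimal_of_isSimpleRing [Nontrivial K] (h : IsSimpleRing (SteinbergAlgebra K X)) :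
    IsMinimal X := by
  intro U hUo hU
  refine or_iff_not_imp_left.2 fun hne => Set.eq_univ_of_forall fun y => ?_
  obtain ⟨x, hx⟩ := Set.nonempty_iff_ne_empty.2 hne
  obtain ⟨k, hk⟩ := exists_ne (0 : K)
  obtain ⟨V, hVc, hVo, hxV, -, hVU⟩ := exists_compact_open_units hUo hx
  obtain ⟨W, hWc, hWo, hyW, -⟩ := exists_compact_open_units isOpen_univ (Set.mem_univ y)
  have hmem : charFun k hVc hVo ∈ invariantIdeal K hU :=
    (mem_invariantIdeal hU).2 fun a ha => charFun_of_notMem k hVc hVo fun haV => ha (hVU haV)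
  by_contra hy
  have := (mem_invariantIdeal hU).1 (h.mem_of_mem_of_ne_zero _ hmem
    (ne_zero_of_apply_ne_zero (a := unit x) (by rwa [charFun_of_mem k hVc hVo hxV]))
    (charFun k hWc hWo)) (unit y) hy
  exact hk (by rwa [charFun_of_mem k hWc hWo hyW] at this)

end Necessity

/-! ### Necessity of effectiveness -/

section Effective

open CategoryTheory Topology

universe w v u

variable {X : Type u} [Groupoid.{v} X] {K : Type w} [NonUnitalRing K]

/-- The sum of the values of `f` over all arrows from `x` to `y`: the matrix entry at `(y, x)` of
the action of `f` on the finitely supported functions on the unit space. -/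
noncomputable def homSum (f : Arr X → K) (x y : X) : K :=
  ∑ᶠ g : x ⟶ y, f ⟨x, y, g⟩

section

variable [TopologicalSpace (Arr X)] [T2Space (Arr X)]

theorem homSum_charFun (k : K) {U : Set (Arr X)} (hc : IsCompact U) (ho : IsOpen U)
    (hU : Set.InjOn dom U) {b : Arr X} (hb : b ∈ U) :
    homSum (charFun k hc ho).1 (dom b) (cod b) = k := by
  obtain ⟨x, y, g⟩ := b
  refine (finsum_eq_single _ g fun g' hg' => charFun_of_notMem k hc ho fun h => hg' ?_).trans
    (charFun_of_mem k hc ho hb)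
  have e := hU h hb rfl
  injection e

theorem homSum_charFun_eq_zero (k : K) {U : Set (Arr X)} (hc : IsCompact U) (ho : IsOpen U)
    {x y : X} (h : ∀ b ∈ U, dom b = x → cod b ≠ y) :
    homSum (charFun k hc ho).1 x y = 0 :=
  finsum_eq_zero_of_forall_eq_zero fun _ =>
    charFun_of_notMem k hc ho fun hg => h _ hg rfl rfl

end

variable [TopologicalSpace X] [TopologicalSpace (Arr X)] [IsAmpleGroupoid X]

theorem finite_support_hom {f : Arr X → K} (hf : f ∈ steinbergSubgroup K X) (x y : X) :
    Function.HasFiniteSupport fun g : x ⟶ y => f ⟨x, y, g⟩ := by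
  obtain ⟨s, hs, hcov⟩ := exists_finite_cover hf.2
  refine Set.Finite.subset
    (s := ⋃ U ∈ s, {g : x ⟶ y | (⟨x, y, g⟩ : Arr X) ∈ U}) ?_ ?_
  · refine s.finite_toSet.biUnion fun U hU => Set.Subsingleton.finite fun g hg g' hg' => ?_
    have := (hs U hU).2.2.injOn_cod hg hg' rfl
    simpa using this
  · intro g hg
    obtain ⟨U, hU, hgU⟩ := Set.mem_iUnion₂.1 (hcov (subset_tsupport f hg))
    exact Set.mem_iUnion₂.2 ⟨U, hU, hgU⟩

theorem homSum_add {f g : Arr X → K} (hf : f ∈ steinbergSubgroup K X)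
    (hg : g ∈ steinbergSubgroup K X) (x y : X) :
    homSum (f + g) x y = homSum f x y + homSum g x y :=
  finsum_add_distrib (finite_support_hom hf x y) (finite_support_hom hg x y)

variable [T2Space (Arr X)]

/-- The matrix of a product is the product of the matrices; it is enough to see this when the second
factor lives on a bisection, where each column of its matrix has at most one nonzero entry. -/
theorem homSum_convolution_right {f h : Arr X → K} (hf : f ∈ steinbergSubgroup K X)
    (hf0 : ∀ x y, homSum f x y = 0) (hh : h ∈ steinbergSubgroup K X) :
    ∀ x y, homSum (convolution f h) x y = 0 := by
  refine steinberg_induction (P := fun h => ∀ x y, homSum (convolution f h) x y = 0)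
    ?_ ?_ ?_ h hh
  · intro x y
    simp [homSum, convolution]
  · intro h hh h' hh' ih ih' x y
    rw [convolution_add_right hf, homSum_add (convolution_mem hf hh) (convolution_mem hf hh'),
      ih, ih', add_zero]
  · intro h hh U _ _ hU hhU x y
    by_cases hc : ∃ c ∈ U, dom c = x
    · obtain ⟨⟨x', z, c⟩, hcU, hx⟩ := hc
      obtain rfl : x' = x := hx
      -- the substitution `a ↦ a c⁻¹` turns the sum over `x ⟶ y` into one over `z ⟶ y`
      let e : (x' ⟶ y) ≃ (z ⟶ y) :=
        ⟨fun g => Groupoid.inv c ≫ g, fun g => c ≫ g, fun g => by simp, fun g => by simp⟩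
      have key : ∀ g : x' ⟶ y, convolution f h ⟨x', y, g⟩ = f ⟨z, y, e g⟩ * h ⟨x', z, c⟩ := by
        intro g
        refine (convolution_eq_single_right (a := ⟨x', y, g⟩) hU.injOn_dom hhU hcU rfl).trans ?_
        congr 2
        exact comp_mk _ _ _
      unfold homSum
      simp only [key]
      rw [finsum_comp_equiv e (f := fun g => f ⟨z, y, g⟩ * h ⟨x', z, c⟩),
        ← finsum_mul' _ _ (finite_support_hom hf z y)]
      exact mul_eq_zero_of_left (hf0 z y) _
    · exact finsum_eq_zero_of_forall_eq_zero fun g =>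
        convolution_eq_zero_of_dom hhU fun c hcU hcx => hc ⟨c, hcU, hcx⟩

theorem homSum_convolution_left {f h : Arr X → K} (hf : f ∈ steinbergSubgroup K X)
    (hf0 : ∀ x y, homSum f x y = 0) (hh : h ∈ steinbergSubgroup K X) :
    ∀ x y, homSum (convolution h f) x y = 0 := by
  refine steinberg_induction (P := fun h => ∀ x y, homSum (convolution h f) x y = 0)
    ?_ ?_ ?_ h hh
  · intro x y
    simp [homSum, convolution]
  · intro h hh h' hh' ih ih' x y
    rw [convolution_add_left hh hh', homSum_add (convolution_mem hh hf) (convolution_mem hh' hf),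
      ih, ih', add_zero]
  · intro h hh U _ _ hU hhU x y
    by_cases hb : ∃ b ∈ U, cod b = y
    · obtain ⟨⟨z, y', b⟩, hbU, hy⟩ := hb
      obtain rfl : y' = y := hy
      -- the substitution `a ↦ b⁻¹ a` turns the sum over `x ⟶ y` into one over `x ⟶ z`
      let e : (x ⟶ y') ≃ (x ⟶ z) :=
        ⟨fun g => g ≫ Groupoid.inv b, fun g => g ≫ b, fun g => by simp, fun g => by simp⟩
      have key : ∀ g : x ⟶ y', convolution h f ⟨x, y', g⟩ = h ⟨z, y', b⟩ * f ⟨x, z, e g⟩ := by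
        intro g
        refine (convolution_eq_single (a := ⟨x, y', g⟩) hU.injOn_cod hhU hbU rfl).trans ?_
        congr 2
        exact comp_mk _ _ _
      unfold homSum
      simp only [key]
      rw [finsum_comp_equiv e (f := fun g => h ⟨z, y', b⟩ * f ⟨x, z, g⟩),
        ← mul_finsum' _ _ (finite_support_hom hf x z)]
      exact mul_eq_zero_of_right _ (hf0 x z)
    · exact finsum_eq_zero_of_forall_eq_zero fun g =>
        convolution_eq_zero hhU fun b hbU hby => hb ⟨b, hbU, hby⟩

/-- The functions that act as zero on the finitely supported functions on the unit space. -/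
noncomputable def homSumIdeal (K : Type w) [NonUnitalRing K] (X : Type u) [Groupoid.{v} X]
    [TopologicalSpace X] [TopologicalSpace (Arr X)] [IsAmpleGroupoid X] [T2Space (Arr X)] :
    TwoSidedIdeal (SteinbergAlgebra K X) :=
  TwoSidedIdeal.mk' {f | ∀ x y, homSum f.1 x y = 0}
    (fun _ _ => finsum_zero)
    (fun {f g} hf hg x y => by
      refine (homSum_add f.2 g.2 x y).trans ?_
      rw [hf, hg, add_zero])
    (fun {f} hf x y => (finsum_neg_distrib _).trans (neg_eq_zero.2 (hf x y)))
    (fun {h f} hf => homSum_convolution_left f.2 hf h.2)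
    (fun {f h} hf => homSum_convolution_right f.2 hf h.2)

theorem mem_homSumIdeal {f : SteinbergAlgebra K X} :
    f ∈ homSumIdeal K X ↔ ∀ x y, homSum f.1 x y = 0 :=
  TwoSidedIdeal.mem_mk' _ _ _ _ _ _ _

/-- If the groupoid is not effective, there is a compact open bisection `U` of non-identity
isotropy arrows, and `k 1_U - k 1_{d(U)}` is a nonzero function acting as zero. -/
theorem isEffective_of_isSimpleRing [Nontrivial K] (h : IsSimpleRing (SteinbergAlgebra K X)) :
    IsEffective X := by
  refine Set.Subset.antisymm (fun g hg => ?_) (interior_maximal ?_ isOpen_range_unit)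
  swap
  · rintro _ ⟨x, rfl⟩
    rfl
  by_contra hgu
  obtain ⟨k, hk⟩ := exists_ne (0 : K)
  obtain ⟨U, hUc, hUo, hU, hgU, hUsub⟩ := exists_compact_open_subset
    (isOpen_interior.inter isClosed_range_unit.isOpen_compl) ⟨hg, hgu⟩
  have hUiso : ∀ b ∈ U, dom b = cod b := fun b hb =>
    (interior_subset (hUsub hb).1 : b ∈ {g : Arr X | dom g = cod g})
  let V : Set (Arr X) := (unit ∘ dom) '' U
  have hVc : IsCompact V := hUc.image (continuous_unit.comp continuous_dom)
  have hVo : IsOpen V := by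
    have hVeq : V = Set.range (unit : X → Arr X) ∩ dom ⁻¹' (dom '' U) := by
      ext a
      constructor
      · rintro ⟨b, hb, rfl⟩
        exact ⟨⟨_, rfl⟩, b, hb, rfl⟩
      · rintro ⟨⟨x, rfl⟩, b, hb, hbx⟩
        exact ⟨b, hb, congrArg unit hbx⟩
    rw [hVeq]
    exact isOpen_range_unit.inter
      (((IsEtaleGroupoid.isLocalHomeomorph_dom (X := X)).isOpenMap _ hUo).preimage continuous_dom)
  have hVinj : Set.InjOn dom V := injOn_dom_range_unit.mono (by
    rintro _ ⟨b, _, rfl⟩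
    exact ⟨_, rfl⟩)
  have hmem : charFun k hUc hUo + -charFun k hVc hVo ∈ homSumIdeal K X := by
    refine mem_homSumIdeal.2 fun x y => ?_
    refine (homSum_add (charFun k hUc hUo).2 (-charFun k hVc hVo).2 x y).trans ?_
    have hneg : homSum (-charFun k hVc hVo).1 x y = -homSum (charFun k hVc hVo).1 x y :=
      finsum_neg_distrib _
    rw [hneg, ← sub_eq_add_neg, sub_eq_zero]
    by_cases hxy : ∃ b ∈ U, dom b = x ∧ cod b = y
    · obtain ⟨b, hb, rfl, rfl⟩ := hxy
      rw [homSum_charFun k hUc hUo hU.injOn_dom hb, ← hUiso b hb]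
      exact (homSum_charFun k hVc hVo hVinj (b := unit (dom b)) ⟨b, hb, rfl⟩).symm
    · rw [homSum_charFun_eq_zero k hUc hUo fun b hb hx hy => hxy ⟨b, hb, hx, hy⟩,
        homSum_charFun_eq_zero k hVc hVo]
      rintro _ ⟨b, hb, rfl⟩ hx hy
      exact hxy ⟨b, hb, hx, (hUiso b hb).symm.trans hy⟩
  have hne : charFun k hUc hUo + -charFun k hVc hVo ≠ 0 := by
    refine ne_zero_of_apply_ne_zero (a := g) ?_
    rw [add_val, neg_val, charFun_of_mem k hUc hUo hgU, charFun_of_notMem k hVc hVo, neg_zero,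
      add_zero]
    · exact hk
    · rintro ⟨b, _, hb⟩
      exact hgu ⟨_, hb⟩
  have hall := mem_homSumIdeal.1 (h.mem_of_mem_of_ne_zero _ hmem hne (charFun k hVc hVo))
    (dom g) (dom g)
  exact hk ((homSum_charFun k hVc hVo hVinj (b := unit (dom g)) ⟨g, hgU, rfl⟩).symm.trans hall)

end Effective


/-! ### Sufficiency: from a nonzero ideal to a characteristic function of units -/

section UnitsInIdeal

open CategoryTheory Topology

universe w v u

variable {X : Type u} [Groupoid.{v} X] {K : Type w} [NonUnitalRing K]

theorem CenterContainsSUnits.exists_mul_eq (hK : CenterContainsSUnits K) (k : K) :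
    ∃ k' : K, k * k' = k ∧ k' * k = k := by
  obtain ⟨k', hk', h⟩ := hK k
  exact ⟨k', h, by rw [← NonUnitalSubring.mem_center_iff.1 hk' k, h]⟩

variable [TopologicalSpace X] [TopologicalSpace (Arr X)] [IsAmpleGroupoid X]

/-- In an effective groupoid, an open bisection `U` without identities contains no arrow between
points of a suitable nonempty open subset of any given nonempty open set of units: unless `U` has
no arrow starting in that set, it has a non-isotropy arrow there, whose end points can be
separated. -/
theorem IsEffective.exists_open_avoiding_bisection (hE : IsEffective X) {U : Set (Arr X)}
    (hUo : IsOpen U) (hU : Set.InjOn dom U) (hUu : ∀ b ∈ U, b ∉ Set.range (unit : X → Arr X))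
    {W : Set X} (hWo : IsOpen W) (hW : W.Nonempty) :
    ∃ V ⊆ W, IsOpen V ∧ V.Nonempty ∧ ∀ b ∈ U, dom b ∈ V → cod b ∉ V := by
  by_cases hne : ∃ b ∈ U, dom b ∈ W
  swap
  · exact ⟨W, subset_rfl, hWo, hW, fun b hb hbW => absurd ⟨b, hb, hbW⟩ hne⟩
  have hO : IsOpen (U ∩ dom ⁻¹' W) := hUo.inter (hWo.preimage continuous_dom)
  obtain ⟨b, hb, hbne⟩ : ∃ b ∈ U ∩ dom ⁻¹' W, dom b ≠ cod b := by
    by_contra! hiso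
    obtain ⟨b, hbU, hbW⟩ := hne
    have : b ∈ interior {g : Arr X | dom g = cod g} := interior_maximal hiso hO ⟨hbU, hbW⟩
    rw [show interior {g : Arr X | dom g = cod g} = Set.range (unit : X → Arr X) from hE] at this
    exact hUu b hbU this
  have := IsEtaleGroupoid.t2Space (X := X)
  obtain ⟨A, C, hA, hC, hbA, hbC, hAC⟩ := t2_separation hbne
  refine ⟨dom '' (U ∩ dom ⁻¹' W ∩ dom ⁻¹' A ∩ cod ⁻¹' C), ?_, ?_, ⟨_, b, ⟨⟨hb, hbA⟩, hbC⟩, rfl⟩, ?_⟩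
  · rintro _ ⟨c, hc, rfl⟩
    exact hc.1.1.2
  · exact (IsEtaleGroupoid.isLocalHomeomorph_dom (X := X)).isOpenMap _
      ((hO.inter (hA.preimage continuous_dom)).inter (hC.preimage continuous_cod))
  · rintro c hc ⟨c', hc', hcc'⟩ ⟨c'', hc'', hcc''⟩
    obtain rfl := hU hc'.1.1.1 hc hcc'
    have h1 : cod c' ∈ A := hcc'' ▸ hc''.1.2
    exact Set.disjoint_left.1 hAC h1 hc'.2

variable [T2Space (Arr X)]

theorem IsEffective.exists_open_avoiding (hE : IsEffective X) {B : Set (Arr X)}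
    (hB : IsCompact B) (hBu : ∀ b ∈ B, b ∉ Set.range (unit : X → Arr X)) :
    ∀ W : Set X, IsOpen W → W.Nonempty →
      ∃ V ⊆ W, IsOpen V ∧ V.Nonempty ∧ ∀ b ∈ B, dom b ∈ V → cod b ∉ V := by
  refine hB.induction_on (p := fun B => ∀ W : Set X, IsOpen W → W.Nonempty →
    ∃ V ⊆ W, IsOpen V ∧ V.Nonempty ∧ ∀ b ∈ B, dom b ∈ V → cod b ∉ V) ?_ ?_ ?_ ?_
  · exact fun W hWo hW => ⟨W, subset_rfl, hWo, hW, fun b hb => absurd hb (Set.notMem_empty b)⟩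
  · intro s t hst ht W hWo hW
    obtain ⟨V, h1, h2, h3, h4⟩ := ht W hWo hW
    exact ⟨V, h1, h2, h3, fun b hb => h4 b (hst hb)⟩
  · intro s t hs ht W hWo hW
    obtain ⟨V, h1, h2, h3, h4⟩ := hs W hWo hW
    obtain ⟨V', h1', h2', h3', h4'⟩ := ht V h2 h3
    refine ⟨V', h1'.trans h1, h2', h3', ?_⟩
    rintro b (hb | hb) hbV hbV'
    · exact h4 b hb (h1' hbV) (h1' hbV')
    · exact h4' b hb hbV hbV'
  · intro b hb
    obtain ⟨U, -, hUo, hU, hbU, hUu⟩ :=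
      exists_compact_open_subset isClosed_range_unit.isOpen_compl (hBu b hb)
    exact ⟨U, mem_nhdsWithin_of_mem_nhds (hUo.mem_nhds hbU), fun W hWo hW =>
      hE.exists_open_avoiding_bisection hUo hU.injOn_dom hUu hWo hW⟩

variable {J : TwoSidedIdeal (SteinbergAlgebra K X)}

/-- Right multiplication by a function supported on a bisection around `g⁻¹` moves a nonzero value
at `g` to the identity at the codomain of `g`. -/
theorem exists_mem_apply_unit_ne_zero (hK : CenterContainsSUnits K) {f : SteinbergAlgebra K X}
    (hf : f ∈ J) (hf0 : f ≠ 0) : ∃ f' ∈ J, ∃ x, f'.1 (unit x) ≠ 0 := by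
  obtain ⟨g, hg⟩ : ∃ g, f.1 g ≠ 0 := by
    by_contra! h
    exact hf0 (Subtype.ext (funext h))
  obtain ⟨k', hk', -⟩ := hK.exists_mul_eq (f.1 g)
  obtain ⟨U, hUc, hUo, hU, hgU, -⟩ :=
    exists_compact_open_subset (g := inv g) isOpen_univ (Set.mem_univ _)
  refine ⟨f * charFun k' hUc hUo, J.mul_mem_right _ _ hf, cod g, ?_⟩
  have h : (f * charFun k' hUc hUo).1 (unit (cod g)) = f.1 g := by
    refine (convolution_eq_single_right (a := unit (cod g)) hU.injOn_dom
      (support_charFun_subset k' hUc hUo) hgU rfl).trans ?_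
    rw [charFun_of_mem k' hUc hUo hgU]
    refine Eq.trans ?_ hk'
    exact congrArg (fun a => f.1 a * k') ((unit_comp _ _ _).trans (inv_inv g))
  rwa [h]

theorem charFun_mul_apply (k : K) {V : Set (Arr X)} (hVc : IsCompact V) (hVo : IsOpen V)
    (hV : V ⊆ Set.range (unit : X → Arr X)) (f : SteinbergAlgebra K X) (a : Arr X) :
    (charFun k hVc hVo * f).1 a = (charFun k hVc hVo).1 (unit (cod a)) * f.1 a :=
  convolution_units_left ((support_charFun_subset k hVc hVo).trans hV) _ _

theorem mul_charFun_apply (k : K) {V : Set (Arr X)} (hVc : IsCompact V) (hVo : IsOpen V)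
    (hV : V ⊆ Set.range (unit : X → Arr X)) (f : SteinbergAlgebra K X) (a : Arr X) :
    (f * charFun k hVc hVo).1 a = f.1 a * (charFun k hVc hVo).1 (unit (dom a)) :=
  convolution_units_right ((support_charFun_subset k hVc hVo).trans hV) _ _

/-- A nonzero ideal of the Steinberg algebra of an effective groupoid contains a function `k 1_V`
for a nonempty compact open set `V` of units: compress an element that is nonzero at an identity
to a set of units that its part off the units avoids. -/
theorem exists_charFun_units_mem (hK : CenterContainsSUnits K) (hE : IsEffective X)
    {f : SteinbergAlgebra K X} (hf : f ∈ J) (hf0 : f ≠ 0) :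
    ∃ (k : K) (V : Set (Arr X)) (hVc : IsCompact V) (hVo : IsOpen V),
      k ≠ 0 ∧ V.Nonempty ∧ V ⊆ Set.range (unit : X → Arr X) ∧ charFun k hVc hVo ∈ J := by
  obtain ⟨f, hf, x, hx⟩ := exists_mem_apply_unit_ne_zero hK hf hf0
  have hBc : IsCompact (tsupport f.1 ∩ (Set.range (unit : X → Arr X))ᶜ) :=
    f.2.2.isCompact.inter_right isOpen_range_unit.isClosed_compl
  obtain ⟨N, hNW, hNo, ⟨y, hy⟩, hN⟩ := hE.exists_open_avoiding hBc (fun b hb => hb.2)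
    (unit ⁻¹' (f.1 ⁻¹' {f.1 (unit x)})) ((f.2.1.isOpen_fiber _).preimage continuous_unit) ⟨x, rfl⟩
  obtain ⟨V, hVc, hVo, hyV, hVu, hVN⟩ := exists_compact_open_units hNo hy
  obtain ⟨k', hk, hk'⟩ := hK.exists_mul_eq (f.1 (unit x))
  refine ⟨f.1 (unit x), V, hVc, hVo, hx, ⟨_, hyV⟩, hVu, ?_⟩
  have heq : charFun (f.1 (unit x)) hVc hVo = charFun k' hVc hVo * f * charFun k' hVc hVo := by
    refine Subtype.ext (funext fun a => ?_)
    rw [mul_charFun_apply k' hVc hVo hVu, charFun_mul_apply k' hVc hVo hVu]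
    by_cases ha : a ∈ Set.range (unit : X → Arr X)
    · obtain ⟨z, rfl⟩ := ha
      rw [dom_unit, cod_unit]
      by_cases hz : unit z ∈ V
      · have hfz : f.1 (unit z) = f.1 (unit x) := hNW (hVN hz)
        rw [charFun_of_mem _ hVc hVo hz, charFun_of_mem _ hVc hVo hz, hfz, hk', hk]
      · rw [charFun_of_notMem _ hVc hVo hz, charFun_of_notMem _ hVc hVo hz, mul_zero]
    · rw [charFun_of_notMem _ hVc hVo fun h => ha (hVu h)]
      by_cases hd : unit (dom a) ∈ V
      · by_cases hc : unit (cod a) ∈ V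
        · have hfa : f.1 a = 0 := by
            by_contra h
            exact hN a ⟨subset_tsupport _ h, ha⟩ (hVN hd : cod (unit (dom a)) ∈ N)
              (hVN hc : cod (unit (cod a)) ∈ N)
          rw [hfa, mul_zero, zero_mul]
        · rw [charFun_of_notMem _ hVc hVo hc, zero_mul, zero_mul]
      · rw [charFun_of_notMem _ hVc hVo hd, mul_zero]
  rw [heq]
  exact J.mul_mem_right _ _ (J.mul_mem_left _ _ hf)

theorem charFun_mul_charFun (k l : K) {V U : Set (Arr X)} (hVc : IsCompact V) (hVo : IsOpen V)
    (hV : V ⊆ Set.range (unit : X → Arr X)) (hUc : IsCompact U) (hUo : IsOpen U)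
    (hUV : ∀ a ∈ U, unit (cod a) ∈ V) :
    charFun k hVc hVo * charFun l hUc hUo = charFun (k * l) hUc hUo := by
  refine Subtype.ext (funext fun a => ?_)
  rw [charFun_mul_apply k hVc hVo hV]
  by_cases ha : a ∈ U
  · rw [charFun_of_mem _ hVc hVo (hUV a ha), charFun_of_mem _ hUc hUo ha,
      charFun_of_mem _ hUc hUo ha]
  · rw [charFun_of_notMem _ hUc hUo ha, charFun_of_notMem _ hUc hUo ha, mul_zero]

/-- When `K` is simple, the coefficient `k` of a nonzero function `k 1_V` in an ideal, with `V` a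
compact open set of units, can be replaced by any other. -/
theorem charFun_mem_of_charFun_mem (hS : IsSimpleRing K) {k : K} (hk : k ≠ 0)
    {V : Set (Arr X)} (hVc : IsCompact V) (hVo : IsOpen V)
    (hV : V ⊆ Set.range (unit : X → Arr X)) (hkV : charFun k hVc hVo ∈ J) (l : K) :
    charFun l hVc hVo ∈ J := by
  have hVV : ∀ a ∈ V, unit (cod a) ∈ V := fun a ha => by
    obtain ⟨x, rfl⟩ := hV ha
    exact ha
  let L : TwoSidedIdeal K := TwoSidedIdeal.mk' {l | charFun l hVc hVo ∈ J}
    (by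
      have h : charFun (0 : K) hVc hVo = 0 := Subtype.ext (Set.indicator_zero _ _)
      simpa only [Set.mem_ofPred_eq, h] using J.zero_mem)
    (fun {l m} hl hm => by
      have h : charFun (l + m) hVc hVo = charFun l hVc hVo + charFun m hVc hVo :=
        Subtype.ext (Set.indicator_add _ _ _)
      simpa only [Set.mem_ofPred_eq, h] using J.add_mem hl hm)
    (fun {l} hl => by
      have h : charFun (-l) hVc hVo = -charFun l hVc hVo :=
        Subtype.ext (Set.indicator_neg _ _)
      simpa only [Set.mem_ofPred_eq, h] using J.neg_mem hl)
    (fun {m l} hl => by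
      simpa only [Set.mem_ofPred_eq, charFun_mul_charFun m l hVc hVo hV hVc hVo hVV] using
        J.mul_mem_left (charFun m hVc hVo) _ hl)
    (fun {l m} hl => by
      simpa only [Set.mem_ofPred_eq, charFun_mul_charFun l m hVc hVo hV hVc hVo hVV] using
        J.mul_mem_right _ (charFun m hVc hVo) hl)
  have hL : ∀ m, m ∈ L ↔ charFun m hVc hVo ∈ J := fun m => TwoSidedIdeal.mem_mk' _ _ _ _ _ _ _
  exact (hL l).1 (hS.mem_of_mem_of_ne_zero L ((hL k).2 hkV) hk l)

end UnitsInIdeal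

/-! ### Sufficiency: the invariant open set of an ideal -/

section InvariantSet

open CategoryTheory Topology

universe w v u

variable {X : Type u} [Groupoid.{v} X] {K : Type w} [NonUnitalRing K]
  [TopologicalSpace X] [TopologicalSpace (Arr X)] [IsAmpleGroupoid X] [T2Space (Arr X)]

/-- The units near which the ideal `J` contains every function: those having an open
neighbourhood `N` such that all `k 1_U` with `c(U) ⊆ N` lie in `J`. -/
def fullUnits (J : TwoSidedIdeal (SteinbergAlgebra K X)) : Set X :=
  {x | ∃ N : Set X, IsOpen N ∧ x ∈ N ∧ ∀ (k : K) (U : Set (Arr X)) (hUc : IsCompact U)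
    (hUo : IsOpen U), U ⊆ cod ⁻¹' N → charFun k hUc hUo ∈ J}

variable {J : TwoSidedIdeal (SteinbergAlgebra K X)}

theorem isOpen_fullUnits : IsOpen (fullUnits J) := by
  rw [isOpen_iff_mem_nhds]
  rintro x ⟨N, hNo, hxN, hN⟩
  filter_upwards [hNo.mem_nhds hxN] with y hy
  exact ⟨N, hNo, hy, hN⟩

/-- For a bisection `B` around `g`, the factorization `k 1_U = (k' 1_{B⁻¹}) (k' 1_B) (k 1_U)`
transports fullness from `c(g)` to `d(g)`. -/
theorem dom_mem_fullUnits (hK : CenterContainsSUnits K) {g : Arr X} (hg : cod g ∈ fullUnits J) :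
    dom g ∈ fullUnits J := by
  obtain ⟨N, hNo, hgN, hN⟩ := hg
  obtain ⟨B, hBc, hBo, hB, hgB, hBN⟩ :=
    exists_compact_open_subset (hNo.preimage continuous_cod) (show g ∈ cod ⁻¹' N from hgN)
  refine ⟨dom '' B, (IsEtaleGroupoid.isLocalHomeomorph_dom (X := X)).isOpenMap _ hBo,
    ⟨g, hgB, rfl⟩, fun k U hUc hUo hUB => ?_⟩
  have hBio : IsOpen (inv ⁻¹' B : Set (Arr X)) := hBo.preimage continuous_inv
  have hBic : IsCompact (inv ⁻¹' B : Set (Arr X)) := by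
    rw [← Set.image_eq_preimage_of_inverse (f := inv) inv_inv inv_inv]
    exact hBc.image continuous_inv
  have hBi : Set.InjOn cod (inv ⁻¹' B : Set (Arr X)) := by
    intro a ha b hb hab
    rw [← inv_inv a, ← inv_inv b, hB.injOn_dom ha hb hab]
  obtain ⟨k', -, hk'⟩ := hK.exists_mul_eq k
  have heq : charFun k hUc hUo =
      charFun k' hBic hBio * (charFun k' hBc hBo * charFun k hUc hUo) := by
    refine Subtype.ext (funext fun a => Eq.symm ?_)
    by_cases hb : ∃ b ∈ B, dom b = cod a
    · obtain ⟨b, hb, hba⟩ := hb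
      have hbi : inv b ∈ (inv ⁻¹' B : Set (Arr X)) := by simpa using hb
      refine (convolution_eq_single (a := a) hBi (support_charFun_subset k' hBic hBio)
        hbi hba).trans ?_
      refine (congrArg _ (convolution_eq_single hB.injOn_cod (support_charFun_subset k' hBc hBo)
        hb (show cod b = cod (comp (inv (inv b)) a hba) by simp))).trans ?_
      rw [charFun_of_mem k' hBic hBio hbi, charFun_of_mem k' hBc hBo hb]
      refine (congrArg (fun c => k' * (k' * (charFun k hUc hUo).1 c))
        (comp_inv_comp (inv b) a hba)).trans ?_
      by_cases ha : a ∈ U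
      · rw [charFun_of_mem k hUc hUo ha, hk', hk']
      · rw [charFun_of_notMem k hUc hUo ha, mul_zero, mul_zero]
    · refine (convolution_eq_zero (support_charFun_subset k' hBic hBio) fun b hbB hba =>
        hb ⟨inv b, hbB, hba⟩).trans ?_
      exact (charFun_of_notMem k hUc hUo fun ha => hb (hUB ha)).symm
  rw [heq]
  exact J.mul_mem_left _ _ (J.mul_mem_right _ _ (hN k' B hBc hBo hBN))

theorem isInvariant_fullUnits (hK : CenterContainsSUnits K) : IsInvariant (fullUnits J) := by
  refine Set.Subset.antisymm ?_ fun x hx => ⟨unit x, hx, rfl⟩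
  rintro _ ⟨g, hg, rfl⟩
  exact dom_mem_fullUnits hK hg

theorem fullUnits_nonempty (hK : CenterContainsSUnits K) (hE : IsEffective X)
    (hS : IsSimpleRing K) {f : SteinbergAlgebra K X} (hf : f ∈ J) (hf0 : f ≠ 0) :
    (fullUnits J).Nonempty := by
  obtain ⟨k, V, hVc, hVo, hk, ⟨a, ha⟩, hV, hkV⟩ := exists_charFun_units_mem hK hE hf hf0
  obtain ⟨x, rfl⟩ := hV ha
  refine ⟨x, unit ⁻¹' V, hVo.preimage continuous_unit, ha, fun l U hUc hUo hUV => ?_⟩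
  obtain ⟨l', -, hl'⟩ := hK.exists_mul_eq l
  have heq := charFun_mul_charFun l' l hVc hVo hV hUc hUo hUV
  rw [hl'] at heq
  rw [← heq]
  exact J.mul_mem_right _ _ (charFun_mem_of_charFun_mem hS hk hVc hVo hV hkV l')

/-- The restriction of a function to a clopen set of arrows, extended by zero. -/
noncomputable def restrict (f : SteinbergAlgebra K X) {M : Set (Arr X)} (hM : IsClopen M) :
    SteinbergAlgebra K X :=
  ⟨M.indicator f.1, indicator_mem f.2 hM⟩

/-- By compactness of the support, every function is a finite sum of functions `k 1_U` with `c(U)`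
contained in a neighbourhood as in the definition of `fullUnits`. -/
theorem mem_of_fullUnits_eq_univ (hJ : fullUnits J = Set.univ) (f : SteinbergAlgebra K X) :
    f ∈ J := by
  classical
  -- asking for all clopen subsets of `N` makes the property stable under overlapping unions
  obtain ⟨N, hNc, hfN, hN⟩ := f.2.2.isCompact.induction_on
    (p := fun s => ∃ N : Set (Arr X), IsClopen N ∧ s ⊆ N ∧ ∀ (M : Set (Arr X)) (hM : IsClopen M),
      M ⊆ N → restrict f hM ∈ J)
    (by
      refine ⟨∅, isClopen_empty, subset_rfl, fun M hM hMe => ?_⟩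
      obtain rfl := Set.subset_empty_iff.1 hMe
      have h : restrict f hM = 0 :=
        Subtype.ext (Set.indicator_empty f.1)
      rw [h]
      exact J.zero_mem)
    (fun s t hst ⟨N, hNc, htN, hN⟩ => ⟨N, hNc, hst.trans htN, hN⟩)
    (by
      rintro s t ⟨N, hNc, hsN, hN⟩ ⟨N', hNc', htN', hN'⟩
      refine ⟨N ∪ N', hNc.union hNc', Set.union_subset_union hsN htN', fun M hM hMN => ?_⟩
      have h : restrict f hM =
          restrict f (hM.inter hNc) + restrict f (hM.diff hNc) := by
        refine Subtype.ext (funext fun a => ?_)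
        rw [add_val]
        simp only [restrict]
        by_cases haM : a ∈ M <;> by_cases haN : a ∈ N <;> simp [haM, haN]
      rw [h]
      refine J.add_mem (hN _ _ Set.inter_subset_right) (hN' _ _ ?_)
      rintro a ⟨haM, haN⟩
      exact (hMN haM).resolve_left haN)
    (by
      intro a _
      obtain ⟨N, hNo, haN, hN⟩ : cod a ∈ fullUnits J := hJ ▸ Set.mem_univ _
      obtain ⟨U, hUc, hUo, -, haU, hU⟩ := exists_compact_open_subset (g := a)
        ((hNo.preimage continuous_cod).inter (f.2.1.isOpen_fiber (f.1 a))) ⟨haN, rfl⟩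
      refine ⟨U, mem_nhdsWithin_of_mem_nhds (hUo.mem_nhds haU), U, ⟨hUc.isClosed, hUo⟩, subset_rfl,
        fun M hM hMU => ?_⟩
      have hMc : IsCompact M := hUc.of_isClosed_subset hM.1 hMU
      have h : restrict f hM =
          charFun (f.1 a) hMc hM.2 :=
        Subtype.ext (Set.indicator_congr fun b hb => (hU (hMU hb)).2)
      rw [h]
      exact hN _ _ _ _ fun b hb => (hU (hMU hb)).1)
  have h : restrict f hNc = f :=
    Subtype.ext (Set.indicator_eq_self.2 ((subset_tsupport _).trans hfN))
  rw [← h]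
  exact hN N hNc subset_rfl

theorem isSimpleRing_of_isEffective_of_isMinimal [Nontrivial K] [Nonempty X]
    (hK : CenterContainsSUnits K) (hE : IsEffective X) (hM : IsMinimal X) (hS : IsSimpleRing K) :
    IsSimpleRing (SteinbergAlgebra K X) := by
  obtain ⟨k, hk⟩ := exists_ne (0 : K)
  obtain ⟨x⟩ := ‹Nonempty X›
  obtain ⟨V, hVc, hVo, hxV, -⟩ := exists_compact_open_units isOpen_univ (Set.mem_univ x)
  have : Nontrivial (SteinbergAlgebra K X) := ⟨charFun k hVc hVo, 0,
    ne_zero_of_apply_ne_zero (a := unit x) (by rwa [charFun_of_mem k hVc hVo hxV])⟩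
  refine .of_eq_bot_or_eq_top fun J => or_iff_not_imp_left.2 fun hJ => ?_
  obtain ⟨f, hf, hf0⟩ := SetLike.exists_of_lt (bot_lt_iff_ne_bot.2 hJ)
  rw [TwoSidedIdeal.mem_bot] at hf0
  have hfull := (hM _ isOpen_fullUnits (isInvariant_fullUnits hK)).resolve_left
    (fullUnits_nonempty hK hE hS hf hf0).ne_empty
  exact TwoSidedIdeal.ext fun h =>
    ⟨fun _ => TwoSidedIdeal.mem_top _, fun _ => mem_of_fullUnits_eq_univ hfull h⟩

end InvariantSet

end SteinbergAlgebra

theorem mainTheorem3 {K : Type*} [NonUnitalRing K] [Nontrivial K]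
    (hK : SteinbergAlgebra.CenterContainsSUnits K)
    {X : Type*} [CategoryTheory.Groupoid X] [Nonempty X] [TopologicalSpace X]
    [TopologicalSpace (SteinbergAlgebra.Arr X)] [SteinbergAlgebra.IsAmpleGroupoid X]
    [T2Space (SteinbergAlgebra.Arr X)] :
    IsSimpleRing (SteinbergAlgebra K X) ↔
      SteinbergAlgebra.IsEffective X ∧ SteinbergAlgebra.IsMinimal X ∧ IsSimpleRing K :=
  ⟨fun h => ⟨SteinbergAlgebra.isEffective_of_isSimpleRing h,
    SteinbergAlgebra.isMinimal_of_isSimpleRing h, SteinbergAlgebra.isSimpleRing_coeff h⟩,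
    fun ⟨hE, hM, hS⟩ => SteinbergAlgebra.isSimpleRing_of_isEffective_of_isMinimal hK hE hM hS⟩
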